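/- Let $D=\{z\in\mathbb{C}:|z|\le 1\}$ be the closed unit disk. For $n\in\mathbb{N}$ and a real number $M>0$, let $\mathbb{Z}_n^s(D,M)$ be the set of polynomials with integer coefficients, of exact degree $n$, all of whose complex zeros are simple and lie in $D$, and whose leading coefficient has absolute value at most $M$. For every real $M>0$ and every integer $m\ge 1$ there is a constant $C(m,M)>0$, depending only on $m$ and $M$, such that for every integer $n\ge 2$ with $n\ge m$ and every polynomial $P_n(z)=\sum_{k=0}^n a_{k,n}z^k\in\mathbb{Z}_n^s(D,M)$, $$|a_{n-m,n}|\le C(m,M)\,(n\log n)^{m/2}.$$ -/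

import Mathlib

open Polynomial

/-- The set of polynomials with integer coefficients of exact degree `n`,
all of whose complex zeros lie in `E`. -/
def intPolyZerosIn (n : ℕ) (E : Set ℂ) : Set ℤ[X] :=
  {P | P.degree = (n : WithBot ℕ) ∧ ∀ z : ℂ, aeval z P = 0 → z ∈ E}

/-- Those polynomials of `intPolyZerosIn n E` whose complex zeros are all simple. -/
def intPolySimpleZerosIn (n : ℕ) (E : Set ℂ) : Set ℤ[X] :=
  {P | P ∈ intPolyZerosIn n E ∧
    ∀ z : ℂ, aeval z P = 0 → (P.map (Int.castRingHom ℂ)).rootMultiplicity z = 1}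

/-- Schur's class for a set `E` and a bound `M`: integer polynomials of exact degree `n` with
simple complex zeros, all in `E`, and leading coefficient at most `M` in absolute value. -/
def schurClass (n : ℕ) (E : Set ℂ) (M : ℝ) : Set ℤ[X] :=
  {P | P ∈ intPolySimpleZerosIn n E ∧ |(P.leadingCoeff : ℝ)| ≤ M}

/-! By Vieta and Newton it suffices that each power sum `p_k` of the roots, `1 ≤ k ≤ m`, is `O(√(n
log n))`. For `ρ < 1`, the series `∑ ρ^k |p_k|² / k` has nonnegative terms and equals the
regularized energy `∑ -log |1 - ρ z w̄|` over pairs of roots. In the disk this kernel is controlled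
off the diagonal by `-log |z - w|`, whose total is `O(n)` because the discriminant is a nonzero
integer. With `ρ = 1 - 1/n` the diagonal costs `n log n` (`norm_sq_sum_pow_le`). -/

theorem sqrt_mul_norm_sub_le {ρ : ℝ} (h0 : 0 ≤ ρ) (h1 : ρ ≤ 1) {z w : ℂ} (hz : ‖z‖ ≤ 1)
    (hw : ‖w‖ ≤ 1) : √ρ * ‖z - w‖ ≤ ‖1 - ρ * (z * (starRingEnd ℂ) w)‖ := by
  refine abs_le_of_sq_le_sq' ?_ (norm_nonneg _) |>.2
  rw [mul_pow, Real.sq_sqrt h0, Complex.sq_norm, Complex.sq_norm]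
  have hz' : z.re ^ 2 + z.im ^ 2 ≤ 1 := by
    have := Complex.sq_norm z
    rw [Complex.normSq_apply] at this
    nlinarith [norm_nonneg z]
  have hw' : w.re ^ 2 + w.im ^ 2 ≤ 1 := by
    have := Complex.sq_norm w
    rw [Complex.normSq_apply] at this
    nlinarith [norm_nonneg w]
  -- This product is exactly `|1 - ρ z w̄|² - ρ |z - w|²`.
  have key : 0 ≤ (1 - ρ * (z.re ^ 2 + z.im ^ 2)) * (1 - ρ * (w.re ^ 2 + w.im ^ 2)) :=
    mul_nonneg (by nlinarith) (by nlinarith)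
  simp only [Complex.normSq_apply, Complex.sub_re, Complex.sub_im, Complex.mul_re, Complex.mul_im,
    Complex.ofReal_re, Complex.ofReal_im, Complex.one_re, Complex.one_im, Complex.conj_re,
    Complex.conj_im]
  nlinarith

/-- Taylor expansion of `-log (1 - ρ z w̄)`, with `∑ (z w̄)^k = |p_k|²` over all pairs. The term `k
= 0` vanishes since division by zero gives `0`. -/
theorem hasSum_pow_div_mul_norm_sq_sum_pow (S : Finset ℂ) (hS : ∀ z ∈ S, ‖z‖ ≤ 1) {ρ : ℝ}
    (h0 : 0 ≤ ρ) (h1 : ρ < 1) :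
    HasSum (fun k : ℕ ↦ ρ ^ k / k * ‖∑ z ∈ S, z ^ k‖ ^ 2)
      (∑ z ∈ S, ∑ w ∈ S, -Real.log ‖1 - ρ * (z * (starRingEnd ℂ) w)‖) := by
  have hlog : ∀ z ∈ S, ∀ w ∈ S, HasSum (fun k : ℕ ↦ ((ρ * (z * (starRingEnd ℂ) w)) ^ k / k).re)
      (-Real.log ‖1 - ρ * (z * (starRingEnd ℂ) w)‖) := by
    intro z hz w hw
    have hlt : ‖ρ * (z * (starRingEnd ℂ) w)‖ < 1 := by
      rw [norm_mul, norm_mul, Complex.norm_real, RCLike.norm_conj, Real.norm_of_nonneg h0]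
      have : ‖z‖ * ‖w‖ ≤ 1 := mul_le_one₀ (hS z hz) (norm_nonneg _) (hS w hw)
      nlinarith
    simpa [Complex.log_re] using Complex.hasSum_re (Complex.hasSum_taylorSeries_neg_log hlt)
  refine (hasSum_sum fun z hz ↦ hasSum_sum fun w hw ↦ hlog z hz w hw).congr_fun ?_
  intro k
  have : ((‖∑ z ∈ S, z ^ k‖ ^ 2 : ℝ) : ℂ) = ∑ z ∈ S, ∑ w ∈ S, (z * (starRingEnd ℂ) w) ^ k := by
    rw [Complex.ofReal_pow, ← Complex.mul_conj', map_sum, Finset.sum_mul_sum]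
    simp [mul_pow]
  rw [← Complex.ofReal_re (ρ ^ k / k * ‖∑ z ∈ S, z ^ k‖ ^ 2), Complex.ofReal_mul, this,
    Finset.mul_sum, Complex.re_sum]
  refine Finset.sum_congr rfl fun z _ ↦ ?_
  rw [Finset.mul_sum, Complex.re_sum]
  refine Finset.sum_congr rfl fun w _ ↦ ?_
  push_cast
  congr 1
  ring

theorem norm_sq_sum_pow_le (S : Finset ℂ) (hS : ∀ z ∈ S, ‖z‖ ≤ 1) (hn : 2 ≤ S.card) {m : ℕ}
    (hm : 1 ≤ m) :
    ‖∑ z ∈ S, z ^ m‖ ^ 2 ≤ m * 2 ^ m * (S.card * Real.log S.card + S.card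
      + ∑ z ∈ S, ∑ w ∈ S.erase z, -Real.log ‖z - w‖) := by
  set n : ℝ := (S.card : ℝ) with hndef
  have hn2 : (2 : ℝ) ≤ n := by rw [hndef]; exact_mod_cast hn
  have hninv : n⁻¹ ≤ 2⁻¹ := by gcongr
  have hninv0 : 0 < n⁻¹ := by positivity
  -- Each diagonal term is then at most `log n`, and the `n (n - 1)` off-diagonal losses of at most
  -- `1 / (n - 1)` add up to `n`.
  set ρ : ℝ := 1 - n⁻¹ with hρ
  have h0 : 0 < ρ := by linarith
  have h1 : ρ < 1 := by linarith
  have hhalf : 2⁻¹ ≤ ρ := by linarith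
  have hdiag : ∀ z ∈ S, -Real.log ‖1 - ρ * (z * (starRingEnd ℂ) z)‖ ≤ Real.log n := by
    intro z hz
    rw [← Real.log_inv]
    have hz' : ‖z‖ ^ 2 ≤ 1 := pow_le_one₀ (norm_nonneg _) (hS z hz)
    have : ‖1 - ρ * (z * (starRingEnd ℂ) z)‖ = 1 - ρ * ‖z‖ ^ 2 := by
      rw [Complex.mul_conj']
      rw [show (1 : ℂ) - ρ * (‖z‖ : ℂ) ^ 2 = ((1 - ρ * ‖z‖ ^ 2 : ℝ) : ℂ) by push_cast; ring,
        Complex.norm_real, Real.norm_of_nonneg (by nlinarith)]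
    rw [this]
    have hle : n⁻¹ ≤ 1 - ρ * ‖z‖ ^ 2 := by nlinarith
    exact Real.log_le_log (inv_pos.2 (hninv0.trans_le hle)) (inv_le_of_inv_le₀ (by positivity) hle)
  have hoff : ∀ z ∈ S, ∀ w ∈ S.erase z, -Real.log ‖1 - ρ * (z * (starRingEnd ℂ) w)‖ ≤
      -Real.log ‖z - w‖ + (n - 1)⁻¹ := by
    intro z hz w hw
    obtain ⟨hwz, hw⟩ := Finset.mem_erase.1 hw
    have hpos : 0 < ‖z - w‖ := norm_pos_iff.2 (sub_ne_zero.2 hwz.symm)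
    have h := Real.log_le_log (mul_pos (Real.sqrt_pos.2 h0) hpos) (sqrt_mul_norm_sub_le h0.le h1.le (hS z hz) (hS w hw))
    rw [Real.log_mul (Real.sqrt_pos.2 h0).ne' hpos.ne', Real.log_sqrt h0.le] at h
    have h2 := Real.one_sub_inv_le_log_of_pos h0
    have h3 : 1 - ρ⁻¹ = -(n - 1)⁻¹ := by
      have : n - 1 ≠ 0 := by linarith
      have : n ≠ 0 := by linarith
      have : 1 - n⁻¹ ≠ 0 := by linarith
      rw [hρ]
      field_simp
      ring
    have h4 : 0 < (n - 1)⁻¹ := inv_pos.2 (by linarith)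
    linarith
  have hterm := le_hasSum (hasSum_pow_div_mul_norm_sq_sum_pow S hS h0.le h1) m
    fun k _ ↦ by positivity
  have htotal : ∑ z ∈ S, ∑ w ∈ S, -Real.log ‖1 - ρ * (z * (starRingEnd ℂ) w)‖ ≤
      n * Real.log n + n + ∑ z ∈ S, ∑ w ∈ S.erase z, -Real.log ‖z - w‖ := by
    have hz : ∀ z ∈ S, ∑ w ∈ S, -Real.log ‖1 - ρ * (z * (starRingEnd ℂ) w)‖ ≤
        (Real.log n + 1) + ∑ w ∈ S.erase z, -Real.log ‖z - w‖ := by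
      intro z hz
      rw [← Finset.add_sum_erase S _ hz]
      have := Finset.sum_le_sum (hoff z hz)
      rw [Finset.sum_add_distrib, Finset.sum_const, Finset.card_erase_of_mem hz, nsmul_eq_mul,
        Nat.cast_sub (by omega), Nat.cast_one, mul_inv_cancel₀ (by linarith)] at this
      linarith [hdiag z hz]
    refine (Finset.sum_le_sum hz).trans_eq ?_
    rw [Finset.sum_add_distrib, Finset.sum_const, nsmul_eq_mul]
    ring
  have hm0 : (0 : ℝ) < m := by exact_mod_cast hm
  have hlow : (m * 2 ^ m : ℝ)⁻¹ ≤ ρ ^ m / m := by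
    rw [mul_inv, ← inv_pow, mul_comm, ← div_eq_mul_inv]
    gcongr
  have hfin : (m * 2 ^ m : ℝ)⁻¹ * ‖∑ z ∈ S, z ^ m‖ ^ 2 ≤ _ :=
    ((mul_le_mul_of_nonneg_right hlow (sq_nonneg _)).trans hterm).trans htotal
  rwa [inv_mul_le_iff₀ (by positivity)] at hfin

/-- The resultant of `P` and `P'` is a nonzero integer, so its absolute value `|a|^(2n-1) ∏ |z - w|`
is at least `1`; take logarithms. -/
theorem sum_neg_log_norm_sub_roots_le (P : ℤ[X]) (hP : P.natDegree ≠ 0)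
    (hnodup : (P.map (Int.castRingHom ℂ)).roots.Nodup) :
    ∑ z ∈ (P.map (Int.castRingHom ℂ)).roots.toFinset,
      ∑ w ∈ (P.map (Int.castRingHom ℂ)).roots.toFinset.erase z, -Real.log ‖z - w‖ ≤
      2 * P.natDegree * Real.log |(P.leadingCoeff : ℝ)| := by
  set Q := P.map (Int.castRingHom ℂ) with hQ
  set S := Q.roots.toFinset with hSdef
  have hP0 : P ≠ 0 := by rintro rfl; simp at hP
  have hdeg : Q.natDegree = P.natDegree := natDegree_map_eq_of_injective Int.cast_injective P
  have hlead : Q.leadingCoeff = P.leadingCoeff :=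
    leadingCoeff_map_of_injective Int.cast_injective P
  have hlead1 : 1 ≤ |(P.leadingCoeff : ℝ)| := by
    exact_mod_cast Int.one_le_abs (leadingCoeff_ne_zero.2 hP0)
  have hroots : S.val = Q.roots := by rw [hSdef, Multiset.toFinset_val, hnodup.dedup]
  have hcard : S.card = P.natDegree := by
    rw [← Finset.card_val, hroots, ← hdeg]; exact splits_iff_card_roots.1 (IsAlgClosed.splits Q)
  have heval : ∀ z ∈ S, eval z (derivative Q) = Q.leadingCoeff * ∏ w ∈ S.erase z, (z - w) := by
    intro z hz
    have hz' : z ∈ Q.roots := by rwa [hSdef, Multiset.mem_toFinset] at hz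
    conv_lhs => rw [(IsAlgClosed.splits Q).eq_prod_roots]
    rw [derivative_C_mul, eval_C_mul, eval_multiset_prod_X_sub_C_derivative hz', Finset.prod,
      Finset.erase_val, hroots]
  have hres := resultant_eq_prod_eval Q (derivative Q) (P.natDegree - 1)
    (by rw [← hdeg]; exact natDegree_derivative_le Q) (IsAlgClosed.splits Q)
  rw [hdeg, hQ, derivative_map, resultant_map_map, ← hQ, ← hroots] at hres
  set R := resultant P (derivative P) P.natDegree (P.natDegree - 1)
  have hprod : (Multiset.map (fun x ↦ eval x (map (Int.castRingHom ℂ) (derivative P))) S.val).prod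
      = ∏ z ∈ S, (Q.leadingCoeff * ∏ w ∈ S.erase z, (z - w)) := by
    rw [← derivative_map, ← hQ]
    exact Finset.prod_congr rfl heval
  rw [hprod, Finset.prod_mul_distrib, Finset.prod_const, hcard, ← mul_assoc, ← pow_add,
    hlead] at hres
  have hfac : ∀ z ∈ S, ∏ w ∈ S.erase z, ‖z - w‖ ≠ 0 := fun z _ ↦ Finset.prod_ne_zero_iff.2
    fun w hw ↦ norm_ne_zero_iff.2 (sub_ne_zero.2 (Finset.ne_of_mem_erase hw).symm)
  have hnorm : |(R : ℝ)| = |(P.leadingCoeff : ℝ)| ^ (P.natDegree - 1 + P.natDegree) *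
      ∏ z ∈ S, ∏ w ∈ S.erase z, ‖z - w‖ := by
    have := congrArg norm hres
    simpa [norm_prod] using this
  have hne := Finset.prod_ne_zero_iff.2 hfac
  have hR : 1 ≤ |(R : ℝ)| := by
    have : R ≠ 0 := by
      rintro h
      rw [h, Int.cast_zero, abs_zero] at hnorm
      exact mul_ne_zero (pow_ne_zero _ (by linarith)) hne hnorm.symm
    exact_mod_cast Int.one_le_abs this
  have hlog := Real.log_nonneg hR
  rw [hnorm, Real.log_mul (pow_ne_zero _ (by linarith)) hne, Real.log_pow,
    Real.log_prod hfac] at hlog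
  have hinner : ∑ z ∈ S, Real.log (∏ w ∈ S.erase z, ‖z - w‖) =
      -∑ z ∈ S, ∑ w ∈ S.erase z, -Real.log ‖z - w‖ := by
    rw [← Finset.sum_neg_distrib]
    refine Finset.sum_congr rfl fun z hz ↦ ?_
    rw [Real.log_prod (Finset.prod_ne_zero_iff.1 (hfac z hz)), Finset.sum_neg_distrib, neg_neg]
  rw [hinner] at hlog
  have hcast : ((P.natDegree - 1 + P.natDegree : ℕ) : ℝ) ≤ 2 * P.natDegree := by
    exact_mod_cast (by omega : P.natDegree - 1 + P.natDegree ≤ 2 * P.natDegree)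
  linarith [mul_le_mul_of_nonneg_right hcast (Real.log_nonneg hlead1)]

/-- A bound on elementary symmetric functions from a bound on power sums. -/
theorem norm_esymm_le_of_norm_psum_le {σ : Type*} [Fintype σ] (z : σ → ℂ) {A B : ℝ} (hA : 1 ≤ A)
    (hB : 1 ≤ B) (m : ℕ) (h : ∀ k, 1 ≤ k → k ≤ m → ‖∑ i, z i ^ k‖ ≤ A * B) :
    ‖(Finset.univ.val.map z).esymm m‖ ≤ (A * B) ^ m := by
  induction m using Nat.strong_induction_on with
  | _ m ih =>
    obtain rfl | hm := Nat.eq_zero_or_pos m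
    · simp [Multiset.esymm]
    have hAB : 1 ≤ A * B := one_le_mul_of_one_le_of_one_le hA hB
    have hnewton := congrArg (MvPolynomial.aeval z) (MvPolynomial.mul_esymm_eq_sum σ ℂ m)
    simp only [map_mul, map_natCast, map_pow, map_neg, map_one, map_sum,
      MvPolynomial.aeval_esymm_eq_multiset_esymm, MvPolynomial.psum, MvPolynomial.aeval_X]
      at hnewton
    -- Newton's identity writes `m e_m` as a sum of at most `m` such terms, so the factor `m`
    -- cancels.
    have hterm : ∀ a ∈ (Finset.HasAntidiagonal.antidiagonal m).filter (fun a ↦ a.1 < m),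
        ‖(-1) ^ a.1 * (Finset.univ.val.map z).esymm a.1 * ∑ i, z i ^ a.2‖ ≤ (A * B) ^ m := by
      intro a ha
      obtain ⟨ha, hlt⟩ := Finset.mem_filter.1 ha
      rw [Finset.HasAntidiagonal.mem_antidiagonal] at ha
      rw [norm_mul, norm_mul, norm_pow, norm_neg, norm_one, one_pow, one_mul]
      calc _ ≤ (A * B) ^ a.1 * (A * B) :=
            mul_le_mul (ih a.1 hlt fun k h1 h2 ↦ h k h1 (by omega)) (h a.2 (by omega) (by omega))
              (norm_nonneg _) (by positivity)
        _ = (A * B) ^ (a.1 + 1) := (pow_succ _ _).symm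
        _ ≤ _ := pow_le_pow_right₀ hAB hlt
    have hcard : ((Finset.HasAntidiagonal.antidiagonal m).filter (fun a ↦ a.1 < m)).card ≤ m := by
      have hsub : ((Finset.HasAntidiagonal.antidiagonal m).filter (fun a ↦ a.1 < m)).image Prod.fst ⊆
          Finset.range m := by
        intro x hx
        obtain ⟨a, ha, rfl⟩ := Finset.mem_image.1 hx
        exact Finset.mem_range.2 (Finset.mem_filter.1 ha).2
      rw [← Finset.card_image_of_injOn (f := Prod.fst)]
      · simpa using Finset.card_le_card hsub
      · intro a ha b hb hab
        simp only [Finset.coe_filter, Finset.HasAntidiagonal.mem_antidiagonal, Set.mem_ofPred_eq] at ha hb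
        exact Prod.ext hab (by have := ha.1; have := hb.1; omega)
    have hnorm := congrArg norm hnewton
    rw [norm_mul, norm_mul, norm_pow, norm_neg, norm_one, one_pow, one_mul,
      Complex.norm_natCast] at hnorm
    have hsum := (norm_sum_le _ _).trans (Finset.sum_le_card_nsmul _ _ _ hterm)
    rw [← hnorm, nsmul_eq_mul] at hsum
    have : (m : ℝ) * ‖(Finset.univ.val.map z).esymm m‖ ≤ m * (A * B) ^ m :=
      hsum.trans (by gcongr)
    exact le_of_mul_le_mul_left this (by exact_mod_cast hm)

/-- The constant `C` is chosen after `M` and `m` only, and so is uniform in `n` and `P`. -/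
theorem theorem2p7 (M : ℝ) (hM : 0 < M) (m : ℕ) (hm : 1 ≤ m) :
    ∃ C : ℝ, 0 < C ∧ ∀ n : ℕ, 2 ≤ n → m ≤ n →
      ∀ P ∈ schurClass n (Metric.closedBall (0 : ℂ) 1) M,
        |(P.coeff (n - m) : ℝ)| ≤ C * ((n : ℝ) * Real.log (n : ℝ)) ^ ((m : ℝ) / 2) := by
  -- Since `log n ≥ 1/2`, one has `n ≤ 2 n log n`: hence `3 = 1 + 2`, and the energy bound `2 n |log
  -- M|` gives the `4`.
  set K : ℝ := m * 2 ^ m * (3 + 4 * |Real.log M|) with hK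
  have hm1 : (1 : ℝ) ≤ m := by exact_mod_cast hm
  have hK1 : 1 ≤ K := one_le_mul_of_one_le_of_one_le
    (one_le_mul_of_one_le_of_one_le hm1 (one_le_pow₀ (by norm_num)))
    (by linarith [abs_nonneg (Real.log M)])
  refine ⟨M * √K ^ m, mul_pos hM (pow_pos (Real.sqrt_pos.2 (by linarith)) m), ?_⟩
  rintro n hn hmn P ⟨⟨⟨hdeg, hdisk⟩, hsimple⟩, hlead⟩
  have hnat : P.natDegree = n := natDegree_eq_of_degree_eq_some hdeg
  have hP0 : P ≠ 0 := by rintro rfl; simp at hnat; omega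
  set Q := P.map (Int.castRingHom ℂ) with hQ
  have hQ0 : Q ≠ 0 := (Polynomial.map_ne_zero_iff Int.cast_injective).2 hP0
  have hQdeg : Q.natDegree = n := (natDegree_map_eq_of_injective Int.cast_injective P).trans hnat
  have hQlead : Q.leadingCoeff = P.leadingCoeff :=
    leadingCoeff_map_of_injective Int.cast_injective P
  have hmem : ∀ z ∈ Q.roots, aeval z P = 0 := by
    intro z hz
    have := (mem_roots hQ0).1 hz
    rwa [IsRoot.def, hQ, eval_map, ← algebraMap_int_eq, ← aeval_def] at this
  have hnodup : Q.roots.Nodup := by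
    rw [Multiset.nodup_iff_count_le_one]
    intro z
    by_cases hz : z ∈ Q.roots
    · rw [count_roots, hsimple z (hmem z hz)]
    · rw [Multiset.count_eq_zero_of_notMem hz]; exact zero_le_one
  set S := Q.roots.toFinset with hS
  have hSroots : S.val = Q.roots := by rw [hS, Multiset.toFinset_val, hnodup.dedup]
  have hQcard : Q.roots.card = Q.natDegree := splits_iff_card_roots.1 (IsAlgClosed.splits Q)
  have hcard : S.card = n := by rw [← Finset.card_val, hSroots, hQcard, hQdeg]
  have hball : ∀ z ∈ S, ‖z‖ ≤ 1 := by
    intro z hz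
    simpa using hdisk z (hmem z (by rwa [hS, Multiset.mem_toFinset] at hz))
  have hlead1 : 1 ≤ |(P.leadingCoeff : ℝ)| := by
    exact_mod_cast Int.one_le_abs (leadingCoeff_ne_zero.2 hP0)
  have hn2 : (2 : ℝ) ≤ n := by exact_mod_cast hn
  have hlogn : 1 / 2 ≤ Real.log n :=
    (by linarith [Real.log_two_gt_d9] : 1 / 2 ≤ Real.log 2).trans
      (Real.log_le_log (by norm_num) hn2)
  have hnlog : 1 ≤ n * Real.log n := by nlinarith
  have henergy := sum_neg_log_norm_sub_roots_le P (by omega) hnodup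
  rw [hnat] at henergy
  have hloglead : Real.log |(P.leadingCoeff : ℝ)| ≤ |Real.log M| :=
    (Real.log_le_log (by linarith) hlead).trans (le_abs_self _)
  have hpsum : ∀ k, 1 ≤ k → k ≤ m → ‖∑ z ∈ S, z ^ k‖ ≤ √K * √(n * Real.log n) := by
    intro k hk hkm
    rw [← Real.sqrt_mul (by linarith)]
    refine Real.le_sqrt_of_sq_le ((norm_sq_sum_pow_le S hball (by omega) hk).trans ?_)
    rw [hcard]
    have hle : (k * 2 ^ k : ℝ) ≤ m * 2 ^ m := by
      gcongr
      norm_num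
    have hpos := abs_nonneg (Real.log M)
    have hsum : n * Real.log n + n + ∑ z ∈ S, ∑ w ∈ S.erase z, -Real.log ‖z - w‖ ≤
        (3 + 4 * |Real.log M|) * (n * Real.log n) := by
      have h1 : (2 * n : ℝ) * Real.log |(P.leadingCoeff : ℝ)| ≤ 2 * n * |Real.log M| := by gcongr
      have h2 : (n : ℝ) ≤ 2 * (n * Real.log n) := by nlinarith
      nlinarith
    calc _ ≤ (k * 2 ^ k : ℝ) * ((3 + 4 * |Real.log M|) * (n * Real.log n)) := by gcongr
      _ ≤ (m * 2 ^ m : ℝ) * ((3 + 4 * |Real.log M|) * (n * Real.log n)) := by gcongr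
      _ = _ := by rw [hK]; ring
  have hesymm := norm_esymm_le_of_norm_psum_le (fun z : S ↦ (z : ℂ)) (Real.one_le_sqrt.2 hK1)
    (Real.one_le_sqrt.2 hnlog) m fun k h1 h2 ↦ by
      rw [Finset.sum_coe_sort S (fun z ↦ z ^ k)]
      exact hpsum k h1 h2
  have hval : (Finset.univ : Finset S).val.map (fun z : S ↦ (z : ℂ)) = Q.roots := by
    rw [← hSroots]
    exact Multiset.attach_map_val S.val
  rw [hval] at hesymm
  have hvieta := coeff_eq_esymm_roots_of_card hQcard (k := n - m) (by omega)
  rw [hQdeg, Nat.sub_sub_self hmn, hQlead, hQ, coeff_map, ← hQ] at hvieta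
  have hcoeff : |(P.coeff (n - m) : ℝ)| = |(P.leadingCoeff : ℝ)| * ‖Q.roots.esymm m‖ := by
    simpa using congrArg norm hvieta
  have hrpow : √(n * Real.log n) ^ m = ((n : ℝ) * Real.log n) ^ ((m : ℝ) / 2) := by
    rw [Real.sqrt_eq_rpow, ← Real.rpow_natCast, ← Real.rpow_mul (by linarith)]
    congr 1
    ring
  rw [hcoeff, ← hrpow, mul_assoc, ← mul_pow]
  exact mul_le_mul hlead hesymm (norm_nonneg _) hM.le
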